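/- For a topological space $Y$, let $\mathrm{D}(Y)$ be the collection of all families $\mathcal U$ of subsets of $Y$ such that $\bigcup\mathcal U$ is dense in $Y$; let $\mathrm{D_o}(Y)$ be the collection of all $\mathcal U\in\mathrm{D}(Y)$ all of whose members are open; let $\mathrm{O}(Y)$ be the collection of all open covers of $Y$; and let $\Omega(Y)$ be the collection of all $\mathcal U\in\mathrm{O}(Y)$ such that $Y\notin\mathcal U$ and every finite subset of $Y$ is contained in some member of $\mathcal U$. For collections $\mathscr A,\mathscr B$ of families of sets, $S_1(\mathscr A,\mathscr B)$ says that for all $\mathcal U_1,\mathcal U_2,\ldots\in\mathscr A$ there are $U_n\in\mathcal U_n$ such that $\{U_n:n\in\mathbb N\}\in\mathscr B$, and $S_{\mathrm{fin}}(\mathscr A,\mathscr B)$ says that for all $\mathcal U_1,\mathcal U_2,\ldots\in\mathscr A$ there are finite $\mathcal F_n\subseteq\mathcal U_n$ such that $\bigcup_n\mathcal F_n\in\mathscr B$. A space $Y$ satisfies such a property if the property holds for the collections formed from $Y$. $C_p(X)$ is the space of continuous functions $X\to\mathbb R$ with the topology of pointwise convergence, and a topology coarser than a given one may be equal to it. **Theorem.**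 Let $X$ be an infinite Tychonoff space. Then $C_p(X)$ satisfies $S_1(\mathrm{D_o},\mathrm{D})$ and does not satisfy $S_{\mathrm{fin}}(\mathrm{O},\mathrm{O})$. Moreover, $C_p(X)$ satisfies $S_{\mathrm{fin}}(\mathrm{D},\mathrm{D})$ (respectively, $S_1(\mathrm{D},\mathrm{D})$) if and only if there is a coarser second countable Tychonoff topology on $X$ and $X$ satisfies $S_{\mathrm{fin}}(\Omega,\Omega)$ (respectively, $S_1(\Omega,\Omega)$). Consequently, in each of the following three cases exactly the listed ones among the eight properties $S(\mathrm{D},\mathrm{D})$, $S(\mathrm{D_o},\mathrm{D})$, $S(\mathrm{O},\mathrm{D})$, $S(\mathrm{O},\mathrm{O})$ with $S\in\{S_{\mathrm{fin}},S_1\}$ are satisfied by $C_p(X)$: 1. If $X$ does not satisfy $S_{\mathrm{fin}}(\Omega,\Omega)$ (for example, $X=\mathbb N^{\mathbb N}$), or there is no coarser second countable Tychonoff topology on $X$: $S_{\mathrm{fin}}(\mathrm{D_o},\mathrm{D})$, $S_{\mathrm{fin}}(\mathrm{O},\mathrm{D})$, $S_1(\mathrm{D_o},\mathrm{D})$, $S_1(\mathrm{O},\mathrm{D})$.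 2. If $X$ satisfies $S_{\mathrm{fin}}(\Omega,\Omega)$ but not $S_1(\Omega,\Omega)$, and there is a coarser second countable Tychonoff topology on $X$ (for example, $X=\mathbb R$): the four properties of case 1 and $S_{\mathrm{fin}}(\mathrm{D},\mathrm{D})$. 3. If $X$ satisfies $S_1(\Omega,\Omega)$ and there is a coarser second countable Tychonoff topology on $X$: the five properties of case 2 and $S_1(\mathrm{D},\mathrm{D})$. -/

import Mathlib

/-- The selection principle `S₁(𝒜, ℬ)`, for collections `𝒜`, `ℬ` of families of subsets of `X`:
for all `𝒰₀, 𝒰₁, … ∈ 𝒜` there are `Vₙ ∈ 𝒰ₙ` such that `{Vₙ : n ∈ ℕ} ∈ ℬ`. -/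
def SelOne {X : Type*} (A B : Set (Set (Set X))) : Prop :=
  ∀ U : ℕ → Set (Set X), (∀ n, U n ∈ A) →
    ∃ V : ℕ → Set X, (∀ n, V n ∈ U n) ∧ Set.range V ∈ B

/-- The selection principle `S_fin(𝒜, ℬ)`: for all `𝒰₀, 𝒰₁, … ∈ 𝒜` there are finite
`ℱₙ ⊆ 𝒰ₙ` such that `⋃ₙ ℱₙ ∈ ℬ`. -/
def SelFin {X : Type*} (A B : Set (Set (Set X))) : Prop :=
  ∀ U : ℕ → Set (Set X), (∀ n, U n ∈ A) →
    ∃ F : ℕ → Set (Set X), (∀ n, (F n).Finite ∧ F n ⊆ U n) ∧ (⋃ n, F n) ∈ B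

/-- `D`: the dense families of subsets of `X`, i.e. those with dense union. -/
def DenseFam (X : Type*) [TopologicalSpace X] : Set (Set (Set X)) :=
  {U | Dense (⋃₀ U)}

/-- `D_o`: the dense families all of whose members are open. -/
def DenseOpenFam (X : Type*) [TopologicalSpace X] : Set (Set (Set X)) :=
  {U | Dense (⋃₀ U) ∧ ∀ V ∈ U, IsOpen V}

/-- `O`: the open covers of `X`. -/
def OpenCov (X : Type*) [TopologicalSpace X] : Set (Set (Set X)) :=
  {U | (∀ V ∈ U, IsOpen V) ∧ ⋃₀ U = Set.univ}

/-- `Ω`: the open covers `𝒰` of `X` with `X ∉ 𝒰` such that every finite subset of `X` is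
contained in some member of `𝒰`. -/
def OmegaCov (X : Type*) [TopologicalSpace X] : Set (Set (Set X)) :=
  {U | U ∈ OpenCov X ∧ (∀ F : Set X, F.Finite → ∃ V ∈ U, F ⊆ V) ∧ Set.univ ∉ U}

/-- There is a coarser (not necessarily strictly) second countable Tychonoff topology on `X`.
In the order on topologies used here, `t ≤ s` says that `s` is coarser than `t`. -/
def HasCoarserSecondCountableTychonoff (X : Type*) [t : TopologicalSpace X] : Prop :=
  ∃ s : TopologicalSpace X, t ≤ s ∧ @SecondCountableTopology X s ∧ @T35Space X s

/-- `C_p(X)`: the continuous real-valued functions on `X`, with the topology of pointwise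
convergence, i.e. as a subspace of the Tychonoff power `ℝ^X`. -/
abbrev Cp (X : Type*) [TopologicalSpace X] : Type _ := {f : X → ℝ // Continuous f}

/-!
For `f ∈ C_p(X)`, basic neighbourhoods restrict `f` at finitely many points only, and on a Tychonoff
space values at finitely many points are arbitrary (`Cp.exists_interpolation`).

`S₁(D_o, D)` is immediate for spaces with a countable `π`-base. In general a Löwenheim–Skolem
argument gives a countable `A ⊆ X` such that the open families remain dense when only rational
cylinders over `A` are considered; one then runs through these countably many cylinders, and
interpolation takes care of constraints outside `A` (`Cp.selOne_denseOpenFam`).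

`S_fin(O, O)` is Menger's property. If `C_p(X)` had it, then zero sets in `X` would be open
(`Cp.eventually_eq_zero_of_selFin`), so that for bump functions `φₙ` with disjoint supports all sums
`∑ aₙ φₙ` would be continuous. Then `C_p(X)` would map onto `ℝ^ℕ` by evaluation at a sequence of
points (`exists_seq_interpolating`), and `ℝ^ℕ` is not Menger.

For the families in `D`, the two properties amount to separability of `C_p(X)` together with
countable (strong) fan tightness. Separability means that `X` has a coarser second countable
Tychonoff topology (`hasCoarser_of_separable`, `separable_of_hasCoarser`). Fan tightness follows
from the selection principle for `ω`-covers applied to the covers by sets `{|f - g| < 1 / (n + 1)}`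
(`Cp.fanTight_of_selFin`, `Cp.strongFanTight_of_selOne`). Conversely, an `ω`-cover `𝒰` yields the
dense family of the sets of functions that equal `1` outside some `U ∈ 𝒰`, and a selection that is
dense in `C_p(X)` gives an `ω`-cover (`mem_omegaCov_of_dense_oneOff`).

For the examples: `ℕ^ℕ` is not Menger; `ℝ` is `σ`-compact, hence so are its finite powers; and `ℝ`
does not have strong measure zero.
-/

open Set Filter Topology

/-! ### Selection principles -/

theorem SelOne.selFin {X : Type*} {A B : Set (Set (Set X))} (h : SelOne A B) : SelFin A B := by
  intro U hU
  obtain ⟨V, hV, hB⟩ := h U hU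
  refine ⟨fun n => {V n}, fun n => ⟨finite_singleton _, singleton_subset_iff.2 (hV n)⟩, ?_⟩
  rwa [iUnion_singleton_eq_range]

theorem SelOne.mono_left {X : Type*} {A A' B : Set (Set (Set X))} (hA : A' ⊆ A)
    (h : SelOne A B) : SelOne A' B :=
  fun U hU => h U fun n => hA (hU n)

theorem openCov_subset_denseOpenFam (Y : Type*) [TopologicalSpace Y] :
    OpenCov Y ⊆ DenseOpenFam Y := by
  rintro U ⟨hU, hcov⟩
  exact ⟨by rw [hcov]; exact dense_univ, hU⟩

/-- The way in which `S_fin` into covers is refuted: finite selections from increasing sequences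
amount to a choice of one bound `N n` in each sequence. -/
theorem SelFin.exists_bound {Y : Type*} {A B : Set (Set (Set Y))} (h : SelFin A B)
    (hB : ∀ V ∈ B, ⋃₀ V = univ) (G : ℕ → ℕ → Set Y) (hG : ∀ n, Monotone (G n))
    (hA : ∀ n, range (G n) ∈ A) : ∃ N : ℕ → ℕ, ∀ y, ∃ n, y ∈ G n (N n) := by
  obtain ⟨F, hF, hFB⟩ := h (fun n => range (G n)) hA
  have key : ∀ n, ∃ N, ∀ V ∈ F n, V ⊆ G n N := by
    intro n
    choose! i hi using fun V (hV : V ∈ F n) => (hF n).2 hV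
    obtain ⟨N, hN⟩ := ((hF n).1.image i).bddAbove
    refine ⟨N, fun V hV => ?_⟩
    rw [← hi V hV]
    exact hG n (hN (mem_image_of_mem i hV))
  choose N hN using key
  refine ⟨N, fun y => ?_⟩
  obtain ⟨V, hV, hy⟩ : y ∈ ⋃₀ (⋃ n, F n) := by rw [hB _ hFB]; trivial
  obtain ⟨n, hn⟩ := mem_iUnion.1 hV
  exact ⟨n, hN n V hn hy⟩

/-- An `ω`-cover remains one, in the sense of covering finite sets by single members, after
removing finitely many members: for each removed member, a point outside it is added to the finite
set to be covered. -/
theorem exists_mem_omegaCov_diff {X : Type*} [TopologicalSpace X] [Nonempty X] {W : Set (Set X)}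
    (hW : W ∈ OmegaCov X) {T : Set (Set X)} (hT : T.Finite) {K : Set X} (hK : K.Finite) :
    ∃ V ∈ W, V ∉ T ∧ K ⊆ V := by
  have hx : ∀ V : Set X, ∃ x, V ≠ univ → x ∉ V := by
    intro V
    by_cases hV : V = univ
    · exact ⟨Classical.arbitrary X, fun h => absurd hV h⟩
    · obtain ⟨x, hx⟩ := (ne_univ_iff_exists_notMem V).1 hV
      exact ⟨x, fun _ => hx⟩
  choose x hx using hx
  obtain ⟨V, hV, hsub⟩ := hW.2.1 (K ∪ x '' T) (hK.union (hT.image x))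
  refine ⟨V, hV, fun hVT => ?_, subset_union_left.trans hsub⟩
  refine hx V ?_ (hsub (Or.inr (mem_image_of_mem x hVT)))
  rintro rfl
  exact hW.2.2 hV

theorem mem_omegaCov_of_forall_finite {X : Type*} [TopologicalSpace X] {U : Set (Set X)}
    (ho : ∀ V ∈ U, IsOpen V) (hne : univ ∉ U)
    (hfin : ∀ F : Set X, F.Finite → ∃ V ∈ U, F ⊆ V) : U ∈ OmegaCov X := by
  refine ⟨⟨ho, eq_univ_of_forall fun x => ?_⟩, hfin, hne⟩
  obtain ⟨V, hV, hx⟩ := hfin {x} (finite_singleton x)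
  exact ⟨V, hV, hx rfl⟩

/-! ### The topology of `C_p(X)` -/

theorem Cp.continuous_eval {X : Type*} [TopologicalSpace X] (x : X) :
    Continuous fun f : Cp X => f.1 x :=
  (continuous_apply x).comp continuous_subtype_val

theorem Cp.mem_nhds_iff {X : Type*} [TopologicalSpace X] {g : Cp X} {W : Set (Cp X)} :
    W ∈ 𝓝 g ↔ ∃ K : Finset X, ∃ ε > 0, ∀ f : Cp X, (∀ x ∈ K, |f.1 x - g.1 x| < ε) → f ∈ W := by
  constructor
  · intro h
    rw [nhds_subtype_eq_comap, mem_comap] at h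
    obtain ⟨t, ht, htW⟩ := h
    rw [nhds_pi, Filter.mem_pi'] at ht
    obtain ⟨K, s, hs, hsub⟩ := ht
    choose ε hε hball using fun x => Metric.mem_nhds_iff.1 (hs x)
    obtain ⟨δ, hδ, hle⟩ : ∃ δ > 0, ∀ x ∈ K, δ ≤ ε x := by
      rcases K.eq_empty_or_nonempty with rfl | hK
      · exact ⟨1, one_pos, by simp⟩
      · obtain ⟨x, hx, hmin⟩ := K.exists_min_image ε hK
        exact ⟨ε x, hε x, hmin⟩
    refine ⟨K, δ, hδ, fun f hf => htW (hsub fun x hx => hball x ?_)⟩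
    rw [Metric.mem_ball, Real.dist_eq]
    exact (hf x hx).trans_le (hle x hx)
  · rintro ⟨K, ε, hε, h⟩
    have : ∀ᶠ f : Cp X in 𝓝 g, ∀ x ∈ K, |f.1 x - g.1 x| < ε := by
      rw [Filter.eventually_all_finset]
      intro x _
      have hc : Continuous fun f : Cp X => |f.1 x - g.1 x| :=
        ((Cp.continuous_eval x).sub continuous_const).abs
      exact hc.continuousAt.eventually_lt continuousAt_const (by simpa using hε)
    exact this.mono h

theorem Cp.mem_closure_iff {X : Type*} [TopologicalSpace X] {g : Cp X} {S : Set (Cp X)} :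
    g ∈ closure S ↔ ∀ K : Finset X, ∀ ε > 0, ∃ f ∈ S, ∀ x ∈ K, |f.1 x - g.1 x| < ε := by
  rw [mem_closure_iff_nhds]
  constructor
  · intro h K ε hε
    obtain ⟨f, hf, hS⟩ := h {f | ∀ x ∈ K, |f.1 x - g.1 x| < ε}
      (Cp.mem_nhds_iff.2 ⟨K, ε, hε, fun f hf => hf⟩)
    exact ⟨f, hS, hf⟩
  · intro h t ht
    obtain ⟨K, ε, hε, hK⟩ := Cp.mem_nhds_iff.1 ht
    obtain ⟨f, hf, hf'⟩ := h K ε hε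
    exact ⟨f, hK f hf', hf⟩

theorem exists_bump {X : Type*} [TopologicalSpace X] [T35Space X] {x : X} {U : Set X}
    (hU : IsOpen U) (hx : x ∈ U) :
    ∃ f : X → ℝ, Continuous f ∧ f x = 1 ∧ (∀ y, 0 ≤ f y ∧ f y ≤ 1) ∧ ∀ y ∉ U, f y = 0 := by
  obtain ⟨f, hf, hfx, hfU⟩ := CompletelyRegularSpace.completely_regular_isOpen x U hU hx
  refine ⟨fun y => 1 - (f y : ℝ), continuous_const.sub (continuous_subtype_val.comp hf), ?_, ?_, ?_⟩
  · simp [hfx]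
  · exact fun y => ⟨sub_nonneg.2 (f y).2.2, sub_le_self _ (f y).2.1⟩
  · intro y hy
    simp [hfU (mem_compl hy)]

/-- Finite interpolation by continuous functions on a Tychonoff space, with the value outside an
open set prescribed as well. -/
theorem Cp.exists_interpolation {X : Type*} [TopologicalSpace X] [T35Space X] (K : Finset X)
    {U : Set X} (hU : IsOpen U) (hK : ↑K ⊆ U) (v : X → ℝ) (c : ℝ) :
    ∃ f : Cp X, (∀ x ∈ K, f.1 x = v x) ∧ ∀ x ∉ U, f.1 x = c := by
  classical
  have hb : ∀ x ∈ K, ∃ f : X → ℝ, Continuous f ∧ f x = 1 ∧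
      ∀ y ∉ U \ ↑(K.erase x), f y = 0 := by
    intro x hx
    have ho : IsOpen (U \ ↑(K.erase x)) := hU.sdiff (K.erase x).finite_toSet.isClosed
    obtain ⟨f, hf, h1, -, h0⟩ := exists_bump ho (x := x) ⟨hK hx, by simp⟩
    exact ⟨f, hf, h1, h0⟩
  choose! b hbc hb1 hb0 using hb
  refine ⟨⟨fun y => c + ∑ x ∈ K, (v x - c) * b x y, continuous_const.add
    (continuous_finsetSum K fun x hx => continuous_const.mul (hbc x hx))⟩, fun x hx => ?_,
    fun y hy => ?_⟩
  · dsimp only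
    rw [Finset.sum_eq_single x, hb1 x hx]
    · ring
    · intro z hz hne
      rw [hb0 z hz x fun h => h.2 (by simp [hx, hne.symm]), mul_zero]
    · exact fun h => absurd hx h
  · dsimp only
    rw [Finset.sum_eq_zero, add_zero]
    intro x hx
    rw [hb0 x hx y fun h => hy h.1, mul_zero]

/-! ### Open dense families -/

/-- The rational cylinder in `C_p(X)` given by finitely many constraints `a < f(x) < b`. -/
def Cp.cylinder {X : Type*} [TopologicalSpace X] (p : Finset (X × ℚ × ℚ)) : Set (Cp X) :=
  {f | ∀ t ∈ p, (t.2.1 : ℝ) < f.1 t.1 ∧ f.1 t.1 < t.2.2}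

theorem Cp.exists_cylinder {X : Type*} [TopologicalSpace X] {W : Set (Cp X)} (hW : IsOpen W)
    {g : Cp X} (hg : g ∈ W) : ∃ p, g ∈ Cp.cylinder p ∧ Cp.cylinder p ⊆ W := by
  classical
  obtain ⟨K, ε, hε, hK⟩ := Cp.mem_nhds_iff.1 (hW.mem_nhds hg)
  choose a ha ha' using fun x => exists_rat_btwn (sub_lt_self (g.1 x) (half_pos hε))
  choose b hb hb' using fun x => exists_rat_btwn (lt_add_of_pos_right (g.1 x) (half_pos hε))
  refine ⟨K.image fun x => (x, a x, b x), ?_, fun f hf => hK f fun x hx => ?_⟩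
  · intro t ht
    obtain ⟨x, -, rfl⟩ := Finset.mem_image.1 ht
    exact ⟨ha' x, hb x⟩
  · obtain ⟨h1, h2⟩ := hf _ (Finset.mem_image_of_mem _ hx)
    dsimp only at h1 h2
    rw [abs_lt]
    constructor <;> linarith [ha x, hb' x]

theorem Cp.isOpen_cylinder {X : Type*} [TopologicalSpace X] (p : Finset (X × ℚ × ℚ)) :
    IsOpen (Cp.cylinder p) := by
  have : Cp.cylinder p = ⋂ t ∈ p, {f : Cp X | (t.2.1 : ℝ) < f.1 t.1 ∧ f.1 t.1 < t.2.2} := by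
    ext f; simp [Cp.cylinder]
  rw [this]
  refine isOpen_biInter_finset fun t _ => ?_
  exact (isOpen_lt continuous_const (Cp.continuous_eval _)).inter
    (isOpen_lt (Cp.continuous_eval _) continuous_const)

/-- The sets of constraints all of whose points lie in `A`. -/
def constraintsOver {X : Type*} (A : Set X) : Set (Finset (X × ℚ × ℚ)) :=
  {p | ∀ t ∈ p, t.1 ∈ A}

theorem countable_constraintsOver {X : Type*} {A : Set X} (hA : A.Countable) :
    (constraintsOver A).Countable := by
  have h : {s : Set (X × ℚ × ℚ) | s.Finite ∧ s ⊆ A ×ˢ univ}.Countable :=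
    countable_ofPred_finite_subset (hA.prod countable_univ)
  refine (h.preimage_of_injOn (f := fun p : Finset (X × ℚ × ℚ) => (p : Set (X × ℚ × ℚ)))
    Finset.coe_injective.injOn).mono ?_
  exact fun p hp => ⟨p.finite_toSet, fun t ht => ⟨hp t ht, trivial⟩⟩

/-- Closing off: countably many operations on finite sets of constraints leave some countable set
of points invariant. -/
theorem exists_countable_invariant {X : Type*}
    (C : ℕ → Finset (X × ℚ × ℚ) → Finset (X × ℚ × ℚ)) :
    ∃ A : Set X, A.Countable ∧ ∀ n, ∀ p ∈ constraintsOver A, C n p ∈ constraintsOver A := by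
  let step : Set X → Set X := fun A =>
    A ∪ ⋃ n, ⋃ p ∈ constraintsOver A, Prod.fst '' (C n p : Set (X × ℚ × ℚ))
  have hmono : Monotone fun k => step^[k] ∅ := by
    refine monotone_nat_of_le_succ fun k => ?_
    rw [Function.iterate_succ_apply']
    exact subset_union_left
  refine ⟨⋃ k, step^[k] ∅, countable_iUnion fun k => ?_, fun n p hp t ht => ?_⟩
  · induction k with
    | zero => exact countable_empty
    | succ k ih =>
      rw [Function.iterate_succ_apply']
      exact ih.union (countable_iUnion fun n => (countable_constraintsOver ih).biUnion
        fun p _ => (C n p).countable_toSet.image _)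
  · obtain ⟨k, hk⟩ : ∃ k, p ∈ constraintsOver (step^[k] ∅) := by
      choose! k hk using fun t (ht : t ∈ p) => mem_iUnion.1 (hp t ht)
      exact ⟨p.sup k, fun t ht => hmono (Finset.le_sup ht) (hk t ht)⟩
    refine mem_iUnion.2 ⟨k + 1, ?_⟩
    rw [Function.iterate_succ_apply']
    exact Or.inr (mem_iUnion.2 ⟨n, mem_biUnion hk (mem_image_of_mem _ ht)⟩)

/-- `C_p(X)` behaves here like a space with a countable `π`-base: a countable set `A` of points is
chosen such that the given families are dense already as seen by cylinders over `A`. -/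
theorem Cp.selOne_denseOpenFam (X : Type*) [TopologicalSpace X] [T35Space X] :
    SelOne (DenseOpenFam (Cp X)) (DenseFam (Cp X)) := by
  classical
  intro U hU
  have key : ∀ n p, ∃ V ∈ U n, ∃ c, (Cp.cylinder p : Set (Cp X)).Nonempty →
      (Cp.cylinder c : Set (Cp X)).Nonempty ∧
        (Cp.cylinder c : Set (Cp X)) ⊆ V ∩ Cp.cylinder p := by
    intro n p
    have hd : Dense (⋃₀ U n) := (hU n).1
    by_cases hp : (Cp.cylinder p : Set (Cp X)).Nonempty
    · obtain ⟨f, hfp, V, hV, hfV⟩ := hd.inter_open_nonempty _ (Cp.isOpen_cylinder p) hp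
      obtain ⟨c, hc, hcs⟩ := Cp.exists_cylinder
        (((hU n).2 V hV).inter (Cp.isOpen_cylinder p)) ⟨hfV, hfp⟩
      exact ⟨V, hV, c, fun _ => ⟨⟨f, hc⟩, hcs⟩⟩
    · have : Nonempty (Cp X) := ⟨⟨fun _ => 0, continuous_const⟩⟩
      obtain ⟨f, V, hV, -⟩ := hd.nonempty
      exact ⟨V, hV, ∅, fun h => absurd h hp⟩
  choose V hVU C hC using key
  obtain ⟨A, hA, hinv⟩ := exists_countable_invariant C
  obtain ⟨e, he⟩ := (countable_constraintsOver hA).exists_eq_range ⟨∅, fun t ht => by simp at ht⟩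
  refine ⟨fun k => V k (e k), fun k => hVU k (e k), ?_⟩
  refine dense_iff_inter_open.2 fun W hW ⟨g, hg⟩ => ?_
  obtain ⟨p, hgp, hpW⟩ := Cp.exists_cylinder hW hg
  obtain ⟨k, hk⟩ : p.filter (fun t => t.1 ∈ A) ∈ range e := by
    rw [← he]
    exact fun t ht => (Finset.mem_filter.1 ht).2
  have hne : (Cp.cylinder (e k) : Set (Cp X)).Nonempty :=
    ⟨g, fun t ht => hgp t (Finset.mem_filter.1 (hk ▸ ht)).1⟩
  obtain ⟨⟨h, hh⟩, hsub⟩ := hC k (e k) hne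
  have hover : C k (e k) ∈ constraintsOver A := hinv k _ (he ▸ mem_range_self k)
  -- `h` meets the constraints over `A`, and `g` those outside `A`
  obtain ⟨f, hf, -⟩ := Cp.exists_interpolation ((p ∪ C k (e k)).image Prod.fst) isOpen_univ
    (subset_univ _) (fun x => if x ∈ A then h.1 x else g.1 x) 0
  refine ⟨f, hpW fun t ht => ?_, V k (e k), mem_range_self k, (hsub fun t ht => ?_).1⟩
  · rw [hf t.1 (Finset.mem_image_of_mem _ (Finset.mem_union_left _ ht))]
    split_ifs with htA
    · refine (hsub hh).2 t ?_
      rw [hk]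
      exact Finset.mem_filter.2 ⟨ht, htA⟩
    · exact hgp t ht
  · rw [hf t.1 (Finset.mem_image_of_mem _ (Finset.mem_union_right _ ht)), if_pos (hover t ht)]
    exact hh t ht

/-! ### Failure of the Menger property -/

/-- If `C_p(X)` is Menger, then every zero set of a continuous function on `X` is open. Otherwise
Menger's property yields bounds `N k` such that every continuous `h` has, for some `k`, a point
with `f > 1 / N k` and `|h - h(p)| < 2⁻ᵏ`, and a continuous function of `f` that grows fast enough
violates this. -/
theorem Cp.eventually_eq_zero_of_selFin {X : Type*} [TopologicalSpace X]
    (hM : SelFin (OpenCov (Cp X)) (OpenCov (Cp X))) {f : X → ℝ} (hf : Continuous f)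
    (h0 : ∀ x, 0 ≤ f x) {p : X} (hp : f p = 0) : ∀ᶠ x in 𝓝 p, f x = 0 := by
  by_contra hcon
  let G : ℕ → ℕ → Set (Cp X) := fun k N =>
    ⋃ x ∈ {x | 1 < N * f x}, {h : Cp X | |h.1 x - h.1 p| < (1 / 2) ^ k}
  have hG : ∀ k, Monotone (G k) := by
    intro k M N hMN
    refine biUnion_subset_biUnion_left fun x hx => ?_
    have : (M : ℝ) * f x ≤ N * f x := mul_le_mul_of_nonneg_right (by exact_mod_cast hMN) (h0 x)
    exact lt_of_lt_of_le hx this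
  obtain ⟨N, hN⟩ := hM.exists_bound (fun V hV => hV.2) G hG fun k => by
    refine ⟨?_, eq_univ_of_forall fun h => ?_⟩
    · rintro _ ⟨N, rfl⟩
      refine isOpen_biUnion fun x _ => ?_
      exact isOpen_lt ((Cp.continuous_eval x).sub (Cp.continuous_eval p)).abs continuous_const
    · have hev : ∀ᶠ x in 𝓝 p, |h.1 x - h.1 p| < (1 / 2) ^ k := by
        have hc : Continuous fun x => |h.1 x - h.1 p| := (h.2.sub continuous_const).abs
        exact hc.continuousAt.eventually_lt continuousAt_const (by simp)
      obtain ⟨x, hx, hxh⟩ := (Filter.Frequently.and_eventually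
        (Filter.not_eventually.1 hcon) hev).exists
      obtain ⟨M, hM⟩ := exists_nat_gt (1 / f x)
      have hpos : 0 < f x := lt_of_le_of_ne (h0 x) (Ne.symm hx)
      exact ⟨_, mem_range_self M, mem_biUnion (x := x) ((div_lt_iff₀ hpos).1 hM) hxh⟩
  let s : ℕ → X → ℝ := fun k x => (1 / 2) ^ k * min 1 (N k * f x)
  have hs0 : ∀ k x, 0 ≤ s k x := fun k x =>
    mul_nonneg (by positivity) (le_min zero_le_one (mul_nonneg (Nat.cast_nonneg _) (h0 x)))
  have hs1 : ∀ k x, s k x ≤ (1 / 2) ^ k := fun k x =>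
    mul_le_of_le_one_right (by positivity) (min_le_left _ _)
  have hsum : ∀ x, Summable fun k => s k x := fun x =>
    Summable.of_nonneg_of_le (fun k => hs0 k x) (fun k => hs1 k x) summable_geometric_two
  have hcont : Continuous fun x => ∑' k, s k x := by
    refine continuous_tsum (fun k => ?_) summable_geometric_two fun k x => ?_
    · exact continuous_const.mul (continuous_const.min (continuous_const.mul hf))
    · rw [Real.norm_eq_abs, abs_of_nonneg (hs0 k x)]
      exact hs1 k x
  obtain ⟨k, hk⟩ := hN ⟨_, hcont⟩
  obtain ⟨x, hx, hlt⟩ := mem_iUnion₂.1 hk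
  have hsp : ∑' k, s k p = 0 := by simp [s, hp]
  have hle : s k x ≤ ∑' j, s j x := (hsum x).le_tsum k fun j _ => hs0 j x
  have hskx : s k x = (1 / 2) ^ k := by
    have h1 : min 1 (N k * f x) = 1 := min_eq_left (le_of_lt hx)
    simp only [s, h1, mul_one]
  have hlt' : |∑' j, s j x - ∑' j, s j p| < (1 / 2) ^ k := hlt
  rw [hsp, sub_zero] at hlt'
  linarith [le_abs_self (∑' j, s j x)]

/-- If all zero sets of continuous functions are open, then along a suitable sequence of points of
`X` a continuous function may take arbitrary values. -/
theorem exists_seq_interpolating (X : Type*) [TopologicalSpace X] [T35Space X] [Infinite X]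
    (hP : ∀ f : X → ℝ, Continuous f → (∀ x, 0 ≤ f x) → ∀ p, f p = 0 → ∀ᶠ x in 𝓝 p, f x = 0) :
    ∃ x : ℕ → X, ∀ a : ℕ → ℝ, ∃ f : Cp X, ∀ n, f.1 (x n) = a n := by
  obtain ⟨U, hinf, hUo, hdisj⟩ := exists_seq_infinite_isOpen_pairwise_disjoint X
  choose x hx using fun n => (hinf n).nonempty
  choose φ hφc hφ1 hφ hφ0 using fun n => exists_bump (hUo n) (hx n)
  refine ⟨x, fun a => ?_⟩
  have hU : ∀ m, ∀ y ∈ U m, ∑' n, a n * φ n y = a m * φ m y := by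
    intro m y hy
    refine tsum_eq_single m fun n hn => ?_
    rw [hφ0 n y fun hny => disjoint_left.1 (hdisj hn) hny hy, mul_zero]
  refine ⟨⟨fun y => ∑' n, a n * φ n y, continuous_iff_continuousAt.2 fun p => ?_⟩, fun n => ?_⟩
  · by_cases hp : ∃ m, p ∈ U m
    · obtain ⟨m, hm⟩ := hp
      have hc : ContinuousAt (fun y => a m * φ m y) p := (continuous_const.mul (hφc m)).continuousAt
      exact hc.congr (((hUo m).eventually_mem hm).mono fun y hy => (hU m y hy).symm)
    · -- outside all `U m` the functions `φ n` vanish simultaneously near `p`, as their common zero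
      -- set is the zero set of a single continuous function
      have hbd : ∀ n y, (1 / 2 : ℝ) ^ n * φ n y ≤ (1 / 2) ^ n := fun n y =>
        mul_le_of_le_one_right (by positivity) (hφ n y).2
      have hnn : ∀ n y, 0 ≤ (1 / 2 : ℝ) ^ n * φ n y := fun n y =>
        mul_nonneg (by positivity) (hφ n y).1
      have hψc : Continuous fun y => ∑' n, (1 / 2 : ℝ) ^ n * φ n y := by
        refine continuous_tsum (fun n => continuous_const.mul (hφc n)) summable_geometric_two
          fun n y => ?_
        rw [Real.norm_eq_abs, abs_of_nonneg (hnn n y)]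
        exact hbd n y
      have hz : ∀ n, φ n p = 0 := fun n => hφ0 n p fun h => hp ⟨n, h⟩
      have hev := hP _ hψc (fun y => tsum_nonneg fun n => hnn n y) p (by simp [hz])
      refine continuousAt_const.congr (f := fun _ => (0 : ℝ)) (hev.mono fun y hy => ?_)
      have hs : Summable fun n => (1 / 2 : ℝ) ^ n * φ n y :=
        Summable.of_nonneg_of_le (fun n => hnn n y) (fun n => hbd n y) summable_geometric_two
      have hall : ∀ n, φ n y = 0 := by
        intro n
        have h1 : (1 / 2 : ℝ) ^ n * φ n y ≤ 0 := by
          rw [← hy]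
          exact hs.le_tsum n fun j _ => hnn j y
        have h2 := le_antisymm h1 (hnn n y)
        exact (mul_eq_zero.1 h2).resolve_left (by positivity)
      simp [hall]
  · dsimp only
    rw [hU n _ (hx n), hφ1, mul_one]

theorem Cp.not_selFin_openCov (X : Type*) [TopologicalSpace X] [T35Space X] [Infinite X] :
    ¬ SelFin (OpenCov (Cp X)) (OpenCov (Cp X)) := by
  intro hM
  obtain ⟨x, hx⟩ := exists_seq_interpolating X fun f hf h0 p hp =>
    Cp.eventually_eq_zero_of_selFin hM hf h0 hp
  let G : ℕ → ℕ → Set (Cp X) := fun n N => {h : Cp X | h.1 (x n) < N}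
  obtain ⟨N, hN⟩ := hM.exists_bound (fun V hV => hV.2) G
    (fun n M N hMN h hh => lt_of_lt_of_le (show h.1 (x n) < M from hh) (by exact_mod_cast hMN))
    fun n => by
      refine ⟨?_, eq_univ_of_forall fun h => ?_⟩
      · rintro _ ⟨N, rfl⟩
        exact isOpen_lt (Cp.continuous_eval _) continuous_const
      · obtain ⟨N, hN⟩ := exists_nat_gt (h.1 (x n))
        exact ⟨_, mem_range_self N, hN⟩
  obtain ⟨f, hf⟩ := hx fun n => N n
  obtain ⟨n, hn⟩ := hN f
  exact absurd (show f.1 (x n) < N n from hn) (by rw [hf n]; exact lt_irrefl _)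

/-! ### Separability of `C_p(X)` -/

/-- A countable dense set of functions separates points, so it embeds `X`, with a coarser topology,
into a countable power of `ℝ`. -/
theorem hasCoarser_of_separable {X : Type*} [t : TopologicalSpace X] [T35Space X]
    (h : TopologicalSpace.SeparableSpace (Cp X)) : HasCoarserSecondCountableTychonoff X := by
  obtain ⟨D, hD, hdense⟩ := h.exists_countable_dense
  have : Countable D := hD.to_subtype
  let e : X → D → ℝ := fun x d => d.1.1 x
  have hinj : Function.Injective e := by
    intro x y hxy
    by_contra hne
    obtain ⟨b, hb, hbx, -, hby⟩ := exists_bump (x := x) (U := {y}ᶜ) isOpen_compl_singleton hne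
    classical
    obtain ⟨f, hf, hfb⟩ := Cp.mem_closure_iff.1 (hdense ⟨b, hb⟩) {x, y} (1 / 2) (by norm_num)
    have h1 := abs_lt.1 (hfb x (by simp))
    have h2 := abs_lt.1 (hfb y (by simp))
    have h3 : f.1 x = f.1 y := congrFun hxy ⟨f, hf⟩
    have h4 : b y = 0 := hby y (by simp)
    dsimp only at h1 h2
    rw [hbx] at h1
    rw [h4] at h2
    linarith [h1.1, h2.2]
  refine ⟨TopologicalSpace.induced e inferInstance, ?_, ?_, ?_⟩
  · exact continuous_iff_le_induced.1 (continuous_pi fun d => d.1.2)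
  · exact TopologicalSpace.secondCountableTopology_induced _ _ _
  · let s : TopologicalSpace X := TopologicalSpace.induced e inferInstance
    exact (Topology.IsEmbedding.mk ⟨rfl⟩ hinj).t35Space

/-- Countably many continuous functions interpolate characteristic functions of points of finite
sets: Urysohn functions for pairs of basic open sets. -/
theorem exists_countable_interpolating (X : Type*) [TopologicalSpace X]
    [SecondCountableTopology X] [T35Space X] :
    ∃ S : Set (X → ℝ), S.Countable ∧ (∀ f ∈ S, Continuous f) ∧
      ∀ (K : Finset X), ∀ x ∈ K, ∃ f ∈ S, f x = 1 ∧ ∀ y ∈ K, y ≠ x → f y = 0 := by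
  classical
  have key : ∀ i : ↥(TopologicalSpace.countableBasis X) × ↥(TopologicalSpace.countableBasis X),
      ∃ g : X → ℝ, Continuous g ∧ (closure i.1.1 ⊆ i.2.1 →
        EqOn g 1 (closure i.1.1) ∧ EqOn g 0 (i.2.1)ᶜ) := by
    intro i
    by_cases hi : closure i.1.1 ⊆ i.2.1
    · obtain ⟨g, h0, h1, -⟩ := exists_continuous_zero_one_of_isClosed
        (TopologicalSpace.isOpen_of_mem_countableBasis i.2.2).isClosed_compl
        (isClosed_closure (s := i.1.1)) (disjoint_compl_left_iff_subset.2 hi)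
      exact ⟨g, g.continuous, fun _ => ⟨h1, h0⟩⟩
    · exact ⟨0, continuous_const, fun h => absurd h hi⟩
  choose f hfc hf using key
  have hcb : Countable ↥(TopologicalSpace.countableBasis X) :=
    (TopologicalSpace.countable_countableBasis X).to_subtype
  refine ⟨range f, countable_range f, forall_mem_range.2 hfc, fun K x hx => ?_⟩
  have hbas := TopologicalSpace.isBasis_countableBasis X
  obtain ⟨V, hV, hxV, hVK⟩ := hbas.exists_subset_of_mem_open (a := x)
    (u := (↑(K.erase x) : Set X)ᶜ) (by simp) (K.erase x).finite_toSet.isClosed.isOpen_compl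
  obtain ⟨U, hU, hxU, hUV⟩ :=
    hbas.exists_closure_subset ((TopologicalSpace.isOpen_of_mem_countableBasis hV).mem_nhds hxV)
  obtain ⟨h1, h0⟩ := hf (⟨U, hU⟩, ⟨V, hV⟩) hUV
  exact ⟨_, mem_range_self _, h1 (subset_closure hxU), fun y hy hyx =>
    h0 fun hyV => hVK hyV (by simp [hy, hyx])⟩

/-- The countable dense set consists of the rational linear combinations of countably many
functions that are continuous already for the coarser topology. -/
theorem separable_of_hasCoarser {X : Type*} [TopologicalSpace X]
    (h : HasCoarserSecondCountableTychonoff X) : TopologicalSpace.SeparableSpace (Cp X) := by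
  obtain ⟨S, hS, hSc, hSK⟩ : ∃ S : Set (X → ℝ), S.Countable ∧ (∀ f ∈ S, Continuous f) ∧
      ∀ (K : Finset X), ∀ x ∈ K, ∃ f ∈ S, f x = 1 ∧ ∀ y ∈ K, y ≠ x → f y = 0 := by
    obtain ⟨s, hts, hs2, hs3⟩ := h
    obtain ⟨S, hS, hSc, hSK⟩ := @exists_countable_interpolating X s hs2 hs3
    exact ⟨S, hS, fun f hf => continuous_le_dom hts (hSc f hf), hSK⟩
  have hcS : Countable S := hS.to_subtype
  let comb : (S →₀ ℚ) → Cp X := fun c =>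
    ⟨fun x => c.sum fun f q => (q : ℝ) * f.1 x,
      continuous_finsetSum _ fun f _ => continuous_const.mul (hSc f.1 f.2)⟩
  refine ⟨range comb, countable_range comb, fun g => ?_⟩
  refine Cp.mem_closure_iff.2 fun K ε hε => ?_
  choose! f hfS hf1 hf0 using hSK K
  choose q hq hq' using fun x => exists_rat_btwn (lt_add_of_pos_right (g.1 x) hε)
  refine ⟨_, mem_range_self (∑ x ∈ K.attach, Finsupp.single ⟨f x, hfS x x.2⟩ (q x)),
    fun y hy => ?_⟩
  have hval : (comb (∑ x ∈ K.attach, Finsupp.single ⟨f x, hfS x x.2⟩ (q x))).1 y = q y := by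
    change ((∑ x ∈ K.attach, Finsupp.single (⟨f x, hfS x x.2⟩ : S) (q x)).sum
      fun f q => (q : ℝ) * f.1 y) = q y
    rw [← Finsupp.sum_finsetSum_index (by simp) (by intros; push_cast; ring)]
    simp only [Finsupp.sum_single_index, Rat.cast_zero, zero_mul]
    rw [Finset.sum_attach K fun x => (q x : ℝ) * f x y, Finset.sum_eq_single y, hf1 y hy, mul_one]
    · intro x hx hne
      rw [hf0 x hx y hy hne.symm, mul_zero]
    · exact fun h => absurd hy h
  rw [hval, abs_lt]
  constructor <;> linarith [hq y, hq' y]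

/-! ### Fan tightness of `C_p(X)` and `ω`-covers of `X` -/

/-- The sets `{|f - g| < 1 / (n + 1)} \ {x}` for `f ∈ A` and `x ∈ X`. Removing a point ensures that
the whole space is not a member. -/
def proximityFam {X : Type*} [TopologicalSpace X] (A : Set (Cp X)) (g : Cp X) (n : ℕ) :
    Set (Set X) :=
  {V | ∃ f ∈ A, ∃ x, V = {y | |f.1 y - g.1 y| < 1 / ((n : ℝ) + 1)} \ {x}}

theorem proximityFam_mem_omegaCov {X : Type*} [TopologicalSpace X] [T1Space X] [Infinite X]
    {A : Set (Cp X)} {g : Cp X} (hg : g ∈ closure A) (n : ℕ) :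
    proximityFam A g n ∈ OmegaCov X := by
  refine mem_omegaCov_of_forall_finite ?_ ?_ ?_
  · rintro _ ⟨f, -, x, rfl⟩
    exact (isOpen_lt (f.2.sub g.2).abs continuous_const).sdiff isClosed_singleton
  · rintro ⟨f, -, x, hx⟩
    exact (hx ▸ mem_univ x : x ∈ {y | |f.1 y - g.1 y| < 1 / ((n : ℝ) + 1)} \ {x}).2 rfl
  · intro F hF
    obtain ⟨f, hf, hfg⟩ := Cp.mem_closure_iff.1 hg hF.toFinset (1 / ((n : ℝ) + 1)) (by positivity)
    obtain ⟨x, hx⟩ := hF.exists_notMem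
    refine ⟨_, ⟨f, hf, x, rfl⟩, fun y hy => ⟨hfg y (by simpa using hy), ?_⟩⟩
    rintro rfl
    exact hx hy

/-- Since finitely many members of an `ω`-cover may be discarded, any finite set is contained in a
member of some `F n` with `n` as large as desired, where the functions in `S n` are close to `g`. -/
theorem mem_closure_of_omegaCov {X : Type*} [TopologicalSpace X] [Nonempty X] {g : Cp X}
    {F : ℕ → Set (Set X)} (hF : ∀ n, (F n).Finite) (hΩ : (⋃ n, F n) ∈ OmegaCov X)
    {S : ℕ → Set (Cp X)}
    (hS : ∀ n, ∀ V ∈ F n, ∃ f ∈ S n, ∀ y ∈ V, |f.1 y - g.1 y| < 1 / ((n : ℝ) + 1)) :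
    g ∈ closure (⋃ n, S n) := by
  refine Cp.mem_closure_iff.2 fun K ε hε => ?_
  obtain ⟨m, hm⟩ := exists_nat_one_div_lt hε
  obtain ⟨V, hV, hVT, hKV⟩ := exists_mem_omegaCov_diff hΩ
    (T := ⋃ n ∈ Iio m, F n) ((finite_Iio m).biUnion fun n _ => hF n) K.finite_toSet
  obtain ⟨n, hn⟩ := mem_iUnion.1 hV
  have hmn : m ≤ n := by
    by_contra hlt
    exact hVT (mem_biUnion (not_le.1 hlt) hn)
  obtain ⟨f, hf, hfV⟩ := hS n V hn
  refine ⟨f, mem_iUnion.2 ⟨n, hf⟩, fun x hx => ?_⟩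
  exact (hfV x (hKV hx)).trans ((Nat.one_div_le_one_div hmn).trans_lt hm)

/-- Countable fan tightness of `C_p(X)`. -/
theorem Cp.fanTight_of_selFin {X : Type*} [TopologicalSpace X] [T1Space X] [Infinite X]
    (h : SelFin (OmegaCov X) (OmegaCov X)) {g : Cp X} {A : ℕ → Set (Cp X)}
    (hg : ∀ n, g ∈ closure (A n)) :
    ∃ S : ℕ → Set (Cp X), (∀ n, (S n).Finite ∧ S n ⊆ A n) ∧ g ∈ closure (⋃ n, S n) := by
  have : Nonempty (Cp X) := ⟨g⟩
  obtain ⟨F, hF, hΩ⟩ := h (fun n => proximityFam (A n) g n)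
    fun n => proximityFam_mem_omegaCov (hg n) n
  choose! f hfA x hfx using fun n V (hV : V ∈ F n) => (hF n).2 hV
  refine ⟨fun n => f n '' F n, fun n => ⟨(hF n).1.image _, ?_⟩,
    mem_closure_of_omegaCov (fun n => (hF n).1) hΩ fun n V hV =>
      ⟨f n V, mem_image_of_mem _ hV, fun y hy => ?_⟩⟩
  · rintro _ ⟨V, hV, rfl⟩
    exact hfA n V hV
  · rw [hfx n V hV] at hy
    exact hy.1

/-- Countable strong fan tightness of `C_p(X)`. -/
theorem Cp.strongFanTight_of_selOne {X : Type*} [TopologicalSpace X] [T1Space X] [Infinite X]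
    (h : SelOne (OmegaCov X) (OmegaCov X)) {g : Cp X} {A : ℕ → Set (Cp X)}
    (hg : ∀ n, g ∈ closure (A n)) :
    ∃ f : ℕ → Cp X, (∀ n, f n ∈ A n) ∧ g ∈ closure (range f) := by
  obtain ⟨V, hV, hΩ⟩ := h (fun n => proximityFam (A n) g n)
    fun n => proximityFam_mem_omegaCov (hg n) n
  choose f hfA x hfx using hV
  refine ⟨f, hfA, ?_⟩
  rw [← iUnion_singleton_eq_range] at hΩ ⊢
  refine mem_closure_of_omegaCov (fun n => finite_singleton _) hΩ fun n W hW =>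
    ⟨f n, rfl, fun y hy => ?_⟩
  rw [mem_singleton_iff.1 hW, hfx n] at hy
  exact hy.1

/-- A countable dense set is approximated by splitting the sequence of dense families into
infinitely many infinite subsequences, one for each point of the dense set. -/
theorem Cp.selFin_denseFam {X : Type*} [TopologicalSpace X] [T1Space X] [Infinite X]
    (hsep : TopologicalSpace.SeparableSpace (Cp X)) (h : SelFin (OmegaCov X) (OmegaCov X)) :
    SelFin (DenseFam (Cp X)) (DenseFam (Cp X)) := by
  intro U hU
  have : Nonempty (Cp X) := ⟨⟨fun _ => 0, continuous_const⟩⟩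
  let d := TopologicalSpace.denseSeq (Cp X)
  choose S hS hd using fun m => Cp.fanTight_of_selFin h (g := d m)
    (A := fun k => ⋃₀ U (Nat.pair m k)) fun k => (show Dense (⋃₀ U _) from hU _) (d m)
  choose! W hWU hW using fun m k f (hf : f ∈ S m k) => (hS m k).2 hf
  refine ⟨fun n => W n.unpair.1 n.unpair.2 '' S n.unpair.1 n.unpair.2,
    fun n => ⟨(hS _ _).1.image _, ?_⟩, ?_⟩
  · rintro _ ⟨f, hf, rfl⟩
    simpa using hWU _ _ f hf
  · refine (dense_closure (s := ⋃₀ _)).1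
      ((TopologicalSpace.denseRange_denseSeq (Cp X)).mono ?_)
    rintro _ ⟨m, rfl⟩
    refine closure_mono (iUnion_subset fun k f hf => ?_) (hd m)
    exact ⟨W m k f, mem_iUnion.2 ⟨Nat.pair m k, by simpa using mem_image_of_mem (W m k) hf⟩,
      hW m k f hf⟩

theorem Cp.selOne_denseFam {X : Type*} [TopologicalSpace X] [T1Space X] [Infinite X]
    (hsep : TopologicalSpace.SeparableSpace (Cp X)) (h : SelOne (OmegaCov X) (OmegaCov X)) :
    SelOne (DenseFam (Cp X)) (DenseFam (Cp X)) := by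
  intro U hU
  have : Nonempty (Cp X) := ⟨⟨fun _ => 0, continuous_const⟩⟩
  let d := TopologicalSpace.denseSeq (Cp X)
  choose f hf hd using fun m => Cp.strongFanTight_of_selOne h (g := d m)
    (A := fun k => ⋃₀ U (Nat.pair m k)) fun k => (show Dense (⋃₀ U _) from hU _) (d m)
  choose W hWU hW using hf
  refine ⟨fun n => W n.unpair.1 n.unpair.2, fun n => by simpa using hWU n.unpair.1 n.unpair.2, ?_⟩
  refine (dense_closure (s := ⋃₀ _)).1
    ((TopologicalSpace.denseRange_denseSeq (Cp X)).mono ?_)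
  rintro _ ⟨m, rfl⟩
  refine closure_mono (range_subset_iff.2 fun k => ?_) (hd m)
  exact ⟨W m k, ⟨Nat.pair m k, by simp⟩, hW m k⟩

theorem Cp.separable_of_selFin {X : Type*} [TopologicalSpace X]
    (h : SelFin (DenseFam (Cp X)) (DenseFam (Cp X))) :
    TopologicalSpace.SeparableSpace (Cp X) := by
  obtain ⟨F, hF, hd⟩ := h (fun _ => range fun f : Cp X => ({f} : Set (Cp X))) fun _ => by
    have : ⋃₀ range (fun f : Cp X => ({f} : Set (Cp X))) = univ :=
      eq_univ_of_forall fun f => ⟨{f}, mem_range_self f, rfl⟩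
    change Dense _
    rw [this]
    exact dense_univ
  refine ⟨_, (countable_iUnion fun n => (hF n).1.countable).sUnion fun V hV => ?_, hd⟩
  obtain ⟨n, hn⟩ := mem_iUnion.1 hV
  obtain ⟨f, rfl⟩ := (hF n).2 hn
  exact countable_singleton f

/-- The continuous functions that equal `1` outside `U`. -/
def Cp.oneOff {X : Type*} [TopologicalSpace X] (U : Set X) : Set (Cp X) :=
  {f | ∀ x ∉ U, f.1 x = 1}

theorem Cp.image_oneOff_mem_denseFam {X : Type*} [TopologicalSpace X] [T35Space X]
    {U : Set (Set X)} (hU : U ∈ OmegaCov X) : Cp.oneOff '' U ∈ DenseFam (Cp X) := by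
  intro g
  refine Cp.mem_closure_iff.2 fun K ε hε => ?_
  obtain ⟨V, hV, hKV⟩ := hU.2.1 K K.finite_toSet
  obtain ⟨f, hfK, hfV⟩ := Cp.exists_interpolation K (hU.1.1 V hV) hKV g.1 1
  exact ⟨f, ⟨_, mem_image_of_mem _ hV, hfV⟩, fun x hx => by simpa [hfK x hx] using hε⟩

/-- A function that is close to `0` on a finite set and equals `1` outside `V` witnesses that `V`
contains the finite set. -/
theorem mem_omegaCov_of_dense_oneOff {X : Type*} [TopologicalSpace X] {U : ℕ → Set (Set X)}
    (hU : ∀ n, U n ∈ OmegaCov X) {W : Set (Set X)} (hWU : W ⊆ ⋃ n, U n)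
    (hW : Cp.oneOff '' W ∈ DenseFam (Cp X)) : W ∈ OmegaCov X := by
  refine mem_omegaCov_of_forall_finite (fun V hV => ?_) (fun h => ?_) fun F hF => ?_
  · obtain ⟨n, hn⟩ := mem_iUnion.1 (hWU hV)
    exact (hU n).1.1 V hn
  · obtain ⟨n, hn⟩ := mem_iUnion.1 (hWU h)
    exact (hU n).2.2 hn
  · obtain ⟨f, ⟨_, ⟨V, hV, rfl⟩, hfV⟩, hf⟩ := Cp.mem_closure_iff.1
      ((show Dense (⋃₀ _) from hW) ⟨fun _ => 0, continuous_const⟩) hF.toFinset 1 one_pos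
    refine ⟨V, hV, fun x hx => ?_⟩
    by_contra hxV
    have := hf x (by simpa using hx)
    rw [hfV x hxV] at this
    norm_num at this

theorem Cp.selFin_omegaCov_of_denseFam {X : Type*} [TopologicalSpace X] [T35Space X]
    (h : SelFin (DenseFam (Cp X)) (DenseFam (Cp X))) : SelFin (OmegaCov X) (OmegaCov X) := by
  intro U hU
  obtain ⟨F, hF, hd⟩ := h (fun n => Cp.oneOff '' U n) fun n => Cp.image_oneOff_mem_denseFam (hU n)
  choose G hGU hGF hG using fun n => exists_subset_image_finite_and.1
    ⟨F n, (hF n).2, (hF n).1, (rfl : F n = F n)⟩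
  refine ⟨G, fun n => ⟨hGF n, hGU n⟩, mem_omegaCov_of_dense_oneOff hU (iUnion_mono hGU) ?_⟩
  rw [image_iUnion]
  simpa only [hG] using hd

theorem Cp.selOne_omegaCov_of_denseFam {X : Type*} [TopologicalSpace X] [T35Space X]
    (h : SelOne (DenseFam (Cp X)) (DenseFam (Cp X))) : SelOne (OmegaCov X) (OmegaCov X) := by
  intro U hU
  obtain ⟨V, hV, hd⟩ := h (fun n => Cp.oneOff '' U n) fun n => Cp.image_oneOff_mem_denseFam (hU n)
  choose G hGU hG using hV
  refine ⟨G, hGU, mem_omegaCov_of_dense_oneOff hU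
    (range_subset_iff.2 fun n => mem_iUnion.2 ⟨n, hGU n⟩) ?_⟩
  rw [← range_comp]
  simpa only [Function.comp_def, hG] using hd

theorem Cp.selFin_denseFam_iff (X : Type*) [TopologicalSpace X] [T35Space X] [Infinite X] :
    SelFin (DenseFam (Cp X)) (DenseFam (Cp X)) ↔
      HasCoarserSecondCountableTychonoff X ∧ SelFin (OmegaCov X) (OmegaCov X) :=
  ⟨fun h => ⟨hasCoarser_of_separable (Cp.separable_of_selFin h),
    Cp.selFin_omegaCov_of_denseFam h⟩,
    fun h => Cp.selFin_denseFam (separable_of_hasCoarser h.1) h.2⟩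

theorem Cp.selOne_denseFam_iff (X : Type*) [TopologicalSpace X] [T35Space X] [Infinite X] :
    SelOne (DenseFam (Cp X)) (DenseFam (Cp X)) ↔
      HasCoarserSecondCountableTychonoff X ∧ SelOne (OmegaCov X) (OmegaCov X) :=
  ⟨fun h => ⟨hasCoarser_of_separable (Cp.separable_of_selFin h.selFin),
    Cp.selOne_omegaCov_of_denseFam h⟩,
    fun h => Cp.selOne_denseFam (separable_of_hasCoarser h.1) h.2⟩

/-! ### The Baire space and the real line -/

theorem not_selFin_omegaCov_baire : ¬ SelFin (OmegaCov (ℕ → ℕ)) (OmegaCov (ℕ → ℕ)) := by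
  intro h
  let G : ℕ → ℕ → Set (ℕ → ℕ) := fun n N => {y | y n < N}
  obtain ⟨N, hN⟩ := h.exists_bound (fun V hV => hV.1.2) G
    (fun n M N hMN y hy => lt_of_lt_of_le (show y n < M from hy) hMN) fun n => by
      refine mem_omegaCov_of_forall_finite ?_ ?_ fun F hF => ?_
      · rintro _ ⟨N, rfl⟩
        exact isOpen_lt (continuous_apply n) continuous_const
      · rintro ⟨N, hN⟩
        exact lt_irrefl N (show (fun _ => N : ℕ → ℕ) ∈ G n N by rw [hN]; trivial)
      · obtain ⟨N, hN⟩ := (hF.image fun y => y n).bddAbove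
        exact ⟨_, mem_range_self (N + 1), fun y hy =>
          Nat.lt_succ_of_le (hN (mem_image_of_mem (fun y : ℕ → ℕ => y n) hy))⟩
  obtain ⟨n, hn⟩ := hN N
  exact lt_irrefl _ (show N n < N n from hn)

/-- The real line is `σ`-compact: a finite part of the `n`-th cover suffices for all `n`-tuples
of points of `[-n, n]`, by compactness of the cube `[-n, n]ⁿ`. -/
theorem selFin_omegaCov_real : SelFin (OmegaCov ℝ) (OmegaCov ℝ) := by
  intro U hU
  have key : ∀ n : ℕ, ∃ F ⊆ U n, F.Finite ∧
      (univ.pi fun _ : Fin n => Icc (-(n : ℝ)) n) ⊆ ⋃ V ∈ F, univ.pi fun _ : Fin n => V := by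
    intro n
    refine (isCompact_univ_pi fun _ => isCompact_Icc).elim_finite_subcover_image
      (fun V hV => isOpen_set_pi finite_univ fun _ _ => (hU n).1.1 V hV) fun x _ => ?_
    obtain ⟨V, hV, hxV⟩ := (hU n).2.1 (range x) (finite_range x)
    exact mem_biUnion hV fun i _ => hxV (mem_range_self i)
  choose F hFU hF hcov using key
  refine ⟨F, fun n => ⟨hF n, hFU n⟩, mem_omegaCov_of_forall_finite (fun V hV => ?_) (fun h => ?_)
    fun K hK => ?_⟩
  · obtain ⟨n, hn⟩ := mem_iUnion.1 hV
    exact (hU n).1.1 V (hFU n hn)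
  · obtain ⟨n, hn⟩ := mem_iUnion.1 h
    exact (hU n).2.2 (hFU n hn)
  · obtain ⟨m, x, hx⟩ := hK.fin_param
    obtain ⟨M, hM⟩ := (hK.image fun y => |y|).bddAbove
    obtain ⟨M', hM'⟩ := exists_nat_gt M
    let n := max m M'
    -- the `m`-tuple `x` enumerating `K` is padded with zeros
    let z : Fin n → ℝ := fun i => if h : (i : ℕ) < m then x ⟨i, h⟩ else 0
    have hz : z ∈ univ.pi fun _ : Fin n => Icc (-(n : ℝ)) n := by
      intro i _
      rw [mem_Icc, ← abs_le]
      by_cases h : (i : ℕ) < m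
      · have h1 : |x ⟨i, h⟩| ≤ M :=
          hM (mem_image_of_mem (fun y : ℝ => |y|) (by rw [← hx.2]; exact mem_range_self _))
        have h2 : (M' : ℝ) ≤ n := by exact_mod_cast le_max_right m M'
        simp only [z, h, dif_pos]
        linarith
      · simp [z, h]
    obtain ⟨V, hV, hzV⟩ := mem_iUnion₂.1 (hcov n hz)
    refine ⟨V, mem_iUnion.2 ⟨n, hV⟩, ?_⟩
    rw [← hx.2]
    rintro _ ⟨j, rfl⟩
    have := hzV ⟨j, lt_of_lt_of_le j.2 (le_max_left m M')⟩ trivial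
    simpa [z] using this

/-- The open sets of measure less than a given `δₙ > 0` form an `ω`-cover, and a union of one such
set for each `n` has measure at most `∑ δₙ`. -/
theorem not_selOne_omegaCov_real : ¬ SelOne (OmegaCov ℝ) (OmegaCov ℝ) := by
  intro h
  obtain ⟨δ, hδ, hsum⟩ := ENNReal.exists_pos_sum_of_countable' (ε := 1) one_ne_zero ℕ
  obtain ⟨V, hV, hΩ⟩ := h (fun n => {V | IsOpen V ∧ MeasureTheory.volume V < δ n}) fun n => by
    refine mem_omegaCov_of_forall_finite (fun V hV => hV.1) (fun hu => ?_) fun F hF => ?_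
    · exact absurd hu.2 (by simp)
    · obtain ⟨V, hFV, hVo, hV⟩ := F.exists_isOpen_lt_of_lt (μ := MeasureTheory.volume) (δ n)
        (by rw [hF.measure_zero]; exact hδ n)
      exact ⟨V, ⟨hVo, hV⟩, hFV⟩
  have hle : MeasureTheory.volume (⋃ n, V n) ≤ ∑' n, δ n :=
    (MeasureTheory.measure_iUnion_le V).trans (ENNReal.tsum_le_tsum fun n => (hV n).2.le)
  have huniv : ⋃ n, V n = univ := by rw [← sUnion_range]; exact hΩ.1.2
  rw [huniv, Real.volume_univ] at hle
  exact absurd (hle.trans_lt hsum) (by simp)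

theorem hasCoarser_real : HasCoarserSecondCountableTychonoff ℝ :=
  ⟨inferInstance, le_rfl, inferInstance, inferInstance⟩

/-! ### The classification -/

theorem mainTheorem10 :
    (∀ (X : Type*) [TopologicalSpace X] [T35Space X] [Infinite X],
      -- what holds, or fails, for every such `X`
      SelOne (DenseOpenFam (Cp X)) (DenseFam (Cp X)) ∧
      ¬ SelFin (OpenCov (Cp X)) (OpenCov (Cp X)) ∧
      -- the two characterizations
      (SelFin (DenseFam (Cp X)) (DenseFam (Cp X)) ↔
        HasCoarserSecondCountableTychonoff X ∧ SelFin (OmegaCov X) (OmegaCov X)) ∧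
      (SelOne (DenseFam (Cp X)) (DenseFam (Cp X)) ↔
        HasCoarserSecondCountableTychonoff X ∧ SelOne (OmegaCov X) (OmegaCov X)) ∧
      -- first setting
      ((¬ SelFin (OmegaCov X) (OmegaCov X) ∨ ¬ HasCoarserSecondCountableTychonoff X) →
        ¬ SelFin (DenseFam (Cp X)) (DenseFam (Cp X)) ∧
        SelFin (DenseOpenFam (Cp X)) (DenseFam (Cp X)) ∧
        SelFin (OpenCov (Cp X)) (DenseFam (Cp X)) ∧
        ¬ SelFin (OpenCov (Cp X)) (OpenCov (Cp X)) ∧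
        ¬ SelOne (DenseFam (Cp X)) (DenseFam (Cp X)) ∧
        SelOne (DenseOpenFam (Cp X)) (DenseFam (Cp X)) ∧
        SelOne (OpenCov (Cp X)) (DenseFam (Cp X)) ∧
        ¬ SelOne (OpenCov (Cp X)) (OpenCov (Cp X))) ∧
      -- second setting
      (SelFin (OmegaCov X) (OmegaCov X) → ¬ SelOne (OmegaCov X) (OmegaCov X) →
        HasCoarserSecondCountableTychonoff X →
        SelFin (DenseFam (Cp X)) (DenseFam (Cp X)) ∧
        SelFin (DenseOpenFam (Cp X)) (DenseFam (Cp X)) ∧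
        SelFin (OpenCov (Cp X)) (DenseFam (Cp X)) ∧
        ¬ SelFin (OpenCov (Cp X)) (OpenCov (Cp X)) ∧
        ¬ SelOne (DenseFam (Cp X)) (DenseFam (Cp X)) ∧
        SelOne (DenseOpenFam (Cp X)) (DenseFam (Cp X)) ∧
        SelOne (OpenCov (Cp X)) (DenseFam (Cp X)) ∧
        ¬ SelOne (OpenCov (Cp X)) (OpenCov (Cp X))) ∧
      -- third setting
      (SelOne (OmegaCov X) (OmegaCov X) → HasCoarserSecondCountableTychonoff X →
        SelFin (DenseFam (Cp X)) (DenseFam (Cp X)) ∧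
        SelFin (DenseOpenFam (Cp X)) (DenseFam (Cp X)) ∧
        SelFin (OpenCov (Cp X)) (DenseFam (Cp X)) ∧
        ¬ SelFin (OpenCov (Cp X)) (OpenCov (Cp X)) ∧
        SelOne (DenseFam (Cp X)) (DenseFam (Cp X)) ∧
        SelOne (DenseOpenFam (Cp X)) (DenseFam (Cp X)) ∧
        SelOne (OpenCov (Cp X)) (DenseFam (Cp X)) ∧
        ¬ SelOne (OpenCov (Cp X)) (OpenCov (Cp X)))) ∧
    -- the example `ℕ^ℕ` for the first setting
    ¬ SelFin (OmegaCov (ℕ → ℕ)) (OmegaCov (ℕ → ℕ)) ∧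
    -- the example `ℝ` for the second setting
    SelFin (OmegaCov ℝ) (OmegaCov ℝ) ∧ ¬ SelOne (OmegaCov ℝ) (OmegaCov ℝ) ∧
    HasCoarserSecondCountableTychonoff ℝ := by
  refine ⟨?_, not_selFin_omegaCov_baire, selFin_omegaCov_real, not_selOne_omegaCov_real,
    hasCoarser_real⟩
  intro X _ _ _
  have hDo := Cp.selOne_denseOpenFam X
  have hOD := hDo.mono_left (openCov_subset_denseOpenFam (Cp X))
  have hOO := Cp.not_selFin_openCov X
  have hOO' : ¬ SelOne (OpenCov (Cp X)) (OpenCov (Cp X)) := fun h => hOO h.selFin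
  have hfin := Cp.selFin_denseFam_iff X
  have hone := Cp.selOne_denseFam_iff X
  refine ⟨hDo, hOO, hfin, hone, fun h => ?_, fun h1 h2 h3 => ?_, fun h1 h2 => ?_⟩
  · have hn : ¬ SelFin (DenseFam (Cp X)) (DenseFam (Cp X)) := fun hD =>
      h.elim (fun h => h (hfin.1 hD).2) fun h => h (hfin.1 hD).1
    exact ⟨hn, hDo.selFin, hOD.selFin, hOO, fun h => hn h.selFin, hDo, hOD, hOO'⟩
  · exact ⟨hfin.2 ⟨h3, h1⟩, hDo.selFin, hOD.selFin, hOO, fun h => h2 (hone.1 h).2, hDo, hOD, hOO'⟩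
  · exact ⟨hfin.2 ⟨h2, h1.selFin⟩, hDo.selFin, hOD.selFin, hOO, hone.2 ⟨h2, h1⟩, hDo, hOD, hOO'⟩
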